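/- An exact category is an additive category $\mathcal B$ with a class of sequences $0\to X\to Y\to Z\to 0$, called exact, such that $\mathcal B$ embeds as a full additive subcategory, closed under extensions, of some abelian category, with the exact sequences of $\mathcal B$ being those that are exact in the abelian category. The first and second maps of exact sequences are the admissible monomorphisms and admissible epimorphisms; an object $I$ is injective if every map to $I$ extends along every admissible monomorphism. Let $\mathcal B$ be an exact category with enough injective objects, that is, every object has an admissible monomorphism into an injective object. Let $\mathcal A\subseteq\mathcal B$ be a full subcategory that contains all injective objects and has the 2-out-of-3 property: if two of the objects of an exact sequence of $\mathcal B$ are in $\mathcal A$, so is the third. View $\mathcal B$ as a Waldhausen category with the admissible monomorphisms as cofibrations and the isomorphisms as weak equivalences. Call an admissible monomorphism with cokernel in $\mathcal A$ an acyclic cofibration, and an admissible epimorphism with injective kernel an acyclic fibration. Let $(\mathcal B,w_{\mathcal A})$ be $\mathcal B$ with the admissible monomorphisms as cofibrations, and as weak equivalences the maps that factor as an acyclic cofibration followed by an acyclic fibration. A Waldhausen category satisfies the extension axiom if, for every map $(a,b,c)$ of sequences $0\to X\hookrightarrow Y\to Y/X\to 0$ with $a$ and $c$ weak equivalences, $b$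 is a weak equivalence; it satisfies the saturation axiom if its weak equivalences satisfy 2-out-of-3 (whenever two of $f$, $g$, $gf$ are weak equivalences, so is the third). A functor between Waldhausen categories is exact if it preserves the zero object, cofibrations, weak equivalences, and pushouts along cofibrations. **Theorem.** The functor $\mathrm{id}\colon\mathcal B\to(\mathcal B,w_{\mathcal A})$ is universal among the exact functors $F\colon\mathcal B\to\mathcal C$ into Waldhausen categories $\mathcal C$ satisfying the extension and saturation axioms such that $0\to FA$ is a weak equivalence for every $A\in\mathcal A$. That is: 1. $\mathcal B$ and $(\mathcal B,w_{\mathcal A})$ are Waldhausen categories, $(\mathcal B,w_{\mathcal A})$ satisfies the extension and saturation axioms, the functor $\mathrm{id}\colon\mathcal B\to(\mathcal B,w_{\mathcal A})$ is exact, and $0\to A$ is a weak equivalence of $(\mathcal B,w_{\mathcal A})$ for every $A\in\mathcal A$. 2. For every Waldhausen category $\mathcal C$ satisfying the extension and saturation axioms and every exact functor $F\colon\mathcal B\to\mathcal C$ such that $0\to FA$ is a weak equivalence for every $A\in\mathcal A$, there is exactly one exact functor $G\colon(\mathcal B,w_{\mathcal A})\to\mathcal C$ with $G\circ\mathrm{id}=F$.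 Moreover, $F$ sends acyclic cofibrations and acyclic fibrations to weak equivalences. -/

import Mathlib

open CategoryTheory CategoryTheory.Limits

universe w w' v v' u u'

namespace WaldLoc

section Waldhausen

/-- The data of two classes of morphisms in a category: cofibrations and weak equivalences. -/
structure CofWeq (C : Type u) [Category.{v} C] where
  /-- the cofibrations -/
  cof : MorphismProperty C
  /-- the weak equivalences -/
  weq : MorphismProperty C

/-- The axioms of a Waldhausen category. -/
structure CofWeq.IsWaldhausen {C : Type u} [Category.{v} C] (W : CofWeq C) : Prop where
  /-- there is a zero object -/
  hasZeroObject : HasZeroObject C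
  /-- the cofibrations form a subcategory -/
  cof_mul : W.cof.IsMultiplicative
  /-- the weak equivalences form a subcategory -/
  weq_mul : W.weq.IsMultiplicative
  /-- (C1) isomorphisms are cofibrations -/
  cof_of_isIso : ∀ {X Y : C} (f : X ⟶ Y), IsIso f → W.cof f
  /-- (C2) the maps `0 ⟶ X` are cofibrations -/
  cof_of_isZero : ∀ {Z X : C} (f : Z ⟶ X), IsZero Z → W.cof f
  /-- (C3) pushouts along cofibrations exist -/
  hasPushout : ∀ {X Y Z : C} (f : X ⟶ Y) (g : X ⟶ Z), W.cof f → HasPushout f g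
  /-- (C3) the cobase change of a cofibration is a cofibration -/
  cof_cobaseChange : ∀ {X Y Z P : C} {f : X ⟶ Y} {g : X ⟶ Z} {inl : Y ⟶ P} {inr : Z ⟶ P},
    IsPushout f g inl inr → W.cof f → W.cof inr
  /-- (W1) isomorphisms are weak equivalences -/
  weq_of_isIso : ∀ {X Y : C} (f : X ⟶ Y), IsIso f → W.weq f
  /-- (W2) the gluing lemma -/
  gluing : ∀ {X Y Z P X' Y' Z' P' : C}
    {i : X ⟶ Y} {j : X ⟶ Z} {inl : Y ⟶ P} {inr : Z ⟶ P}
    {i' : X' ⟶ Y'} {j' : X' ⟶ Z'} {inl' : Y' ⟶ P'} {inr' : Z' ⟶ P'}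
    (x : X ⟶ X') (y : Y ⟶ Y') (z : Z ⟶ Z') (φ : P ⟶ P'),
    IsPushout i j inl inr → IsPushout i' j' inl' inr' →
    W.cof i → W.cof i' → W.weq x → W.weq y → W.weq z →
    i ≫ y = x ≫ i' → j ≫ z = x ≫ j' →
    inl ≫ φ = y ≫ inl' → inr ≫ φ = z ≫ inr' → W.weq φ

/-- `X ⟶ Y ⟶ Q` is an exact (cofibration) sequence `0 → X ↪ Y → Q → 0`: the first map is a
cofibration and `Q` is the pushout of `Y ⟵ X ⟶ 0`. -/
def CofWeq.IsCofSeq {C : Type u} [Category.{v} C] (W : CofWeq C)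
    {X Y Q : C} (i : X ⟶ Y) (p : Y ⟶ Q) : Prop :=
  W.cof i ∧ ∃ (Z : C) (a : X ⟶ Z) (b : Z ⟶ Q), IsZero Z ∧ IsPushout i a p b

/-- The extension axiom. -/
def CofWeq.ExtensionAxiom {C : Type u} [Category.{v} C] (W : CofWeq C) : Prop :=
  ∀ {X Y Q X' Y' Q' : C} {i : X ⟶ Y} {p : Y ⟶ Q} {i' : X' ⟶ Y'} {p' : Y' ⟶ Q'}
    (a : X ⟶ X') (b : Y ⟶ Y') (c : Q ⟶ Q'),
    W.IsCofSeq i p → W.IsCofSeq i' p' → i ≫ b = a ≫ i' → p ≫ c = b ≫ p' →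
    W.weq a → W.weq c → W.weq b

/-- The saturation axiom: two out of three for weak equivalences. -/
def CofWeq.SaturationAxiom {C : Type u} [Category.{v} C] (W : CofWeq C) : Prop :=
  ∀ {X Y Z : C} (f : X ⟶ Y) (g : Y ⟶ Z),
    (W.weq f → W.weq g → W.weq (f ≫ g)) ∧
    (W.weq f → W.weq (f ≫ g) → W.weq g) ∧
    (W.weq g → W.weq (f ≫ g) → W.weq f)

/-- Exact functors: they preserve the zero object, cofibrations, weak equivalences, and
pushouts along cofibrations. -/
structure IsExactFunctor {C : Type u} [Category.{v} C] {D : Type u'} [Category.{v'} D]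
    (W : CofWeq C) (W' : CofWeq D) (F : C ⥤ D) : Prop where
  map_isZero : ∀ {Z : C}, IsZero Z → IsZero (F.obj Z)
  map_cof : ∀ {X Y : C} (f : X ⟶ Y), W.cof f → W'.cof (F.map f)
  map_weq : ∀ {X Y : C} (f : X ⟶ Y), W.weq f → W'.weq (F.map f)
  map_isPushout : ∀ {X Y Z P : C} {f : X ⟶ Y} {g : X ⟶ Z} {inl : Y ⟶ P} {inr : Z ⟶ P},
    IsPushout f g inl inr → W.cof f →
    IsPushout (F.map f) (F.map g) (F.map inl) (F.map inr)

/-- Every object having property `A` is acyclic after applying `F`: the map `0 ⟶ F X` is a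
weak equivalence. -/
def SendsToAcyclic {C : Type u} [Category.{v} C] {D : Type u'} [Category.{v'} D]
    (A : ObjectProperty C) (W' : CofWeq D) (F : C ⥤ D) : Prop :=
  ∀ (X : C), A X → ∀ {Z : D} (f : Z ⟶ F.obj X), IsZero Z → W'.weq f

end Waldhausen

section Exact

variable {B : Type u} [Category.{v} B] [Preadditive B]

/-- `(B, E)` is an exact category: there is a full additive embedding of `B` into an abelian
category, with image closed under extensions, for which `E` is the class of all sequences of
`B` that become short exact. -/
def IsExactCategory (E : ObjectProperty (ShortComplex B)) : Prop :=
  ∃ (𝒜 : Type w) (_ : Category.{w'} 𝒜) (_ : Abelian 𝒜) (ι : B ⥤ 𝒜)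
    (_ : ι.Full) (_ : ι.Faithful) (_ : ι.Additive),
    (∀ S : ShortComplex B, E S ↔ (S.map ι).ShortExact) ∧
    (∀ T : ShortComplex 𝒜, T.ShortExact →
      ι.essImage T.X₁ → ι.essImage T.X₃ → ι.essImage T.X₂)

variable (E : ObjectProperty (ShortComplex B))

/-- Admissible monomorphisms. -/
def admMono : MorphismProperty B := fun _ Y i =>
  ∃ (Q : B) (p : Y ⟶ Q) (h : i ≫ p = 0), E (ShortComplex.mk i p h)

/-- Injective objects of the exact category `(B, E)`: morphisms to `I` extend along admissible
monomorphisms. -/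
def IsInj (I : B) : Prop :=
  ∀ {X Y : B} (i : X ⟶ Y), admMono E i → ∀ f : X ⟶ I, ∃ g : Y ⟶ I, i ≫ g = f

/-- Every object has an admissible monomorphism into an injective object. -/
def EnoughInj : Prop :=
  ∀ X : B, ∃ (I : B) (i : X ⟶ I), IsInj E I ∧ admMono E i

/-- Whenever two of the three objects of an exact sequence have property `A`, so has the
third. -/
def TwoOutOfThree (A : ObjectProperty B) : Prop :=
  ∀ S : ShortComplex B, E S →
    (A S.X₁ → A S.X₂ → A S.X₃) ∧ (A S.X₁ → A S.X₃ → A S.X₂) ∧ (A S.X₂ → A S.X₃ → A S.X₁)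

/-- Acyclic cofibrations: admissible monomorphisms with cokernel in `A`. -/
def acyclicCof (A : ObjectProperty B) : MorphismProperty B := fun _ Y i =>
  ∃ (Q : B) (p : Y ⟶ Q) (h : i ≫ p = 0), E (ShortComplex.mk i p h) ∧ A Q

/-- Acyclic fibrations: admissible epimorphisms with injective kernel. -/
def acyclicFib : MorphismProperty B := fun X _ p =>
  ∃ (K : B) (i : K ⟶ X) (h : i ≫ p = 0), E (ShortComplex.mk i p h) ∧ IsInj E K

/-- The usual structure on an exact category: the cofibrations are the admissible monomorphisms
and the weak equivalences are the isomorphisms. -/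
def isoCofWeq : CofWeq B where
  cof := admMono E
  weq := MorphismProperty.isomorphisms B

/-- The structure `(B, w_A)`: the cofibrations are the admissible monomorphisms, and the weak
equivalences are the morphisms that factor as an acyclic cofibration followed by an acyclic
fibration. -/
def locCofWeq (A : ObjectProperty B) : CofWeq B where
  cof := admMono E
  weq := fun X Y f => ∃ (M : B) (i : X ⟶ M) (p : M ⟶ Y),
    acyclicCof E A i ∧ acyclicFib E p ∧ i ≫ p = f

end Exact

end WaldLoc

/-!
Let `f : X ⟶ Y` be a map of `B`. For a map `g` from `X` to an injective object `I` such that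
`(f, g) : X ⟶ Y ⊞ I` is an admissible monomorphism (any admissible monomorphism `g : X ⟶ I` will
do), the cokernel of `(f, g)` is a mapping cone of `f`. The proof rests on `weq_iff`: the map `f`
is a weak equivalence of `(B, w_A)` if and only if such a cone is in `A`. In one direction, an acyclic
fibration splits because its kernel is injective. The choice of `g` does not matter because the
cones of `f` for `g` and `g'` have a common extension by injective objects, namely the cokernel of
`(f, g, g')`.

By the `3 × 3` lemma (`IsExactCategory.exists_cokernels`), a map of exact sequences has an exact
sequence of cones (`exists_weq_iff`), and so has a composite of two maps. As `A` has the
2-out-of-3 property, this gives the extension and saturation axioms, and the gluing lemma as well,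
since a pushout along an admissible monomorphism is an exact sequence `X → Y ⊞ Z → P`. The
embedding of `B` into an abelian category is used only for the `3 × 3` lemma, the cokernel property
of exact sequences, and the exactness of isomorphic and split sequences.

The functor in the universal property has to be `F` itself, so what remains is that `F` sends weak
equivalences to weak equivalences. Acyclic cofibrations are handled by the extension axiom of the
target, and acyclic fibrations by its saturation axiom, as they have sections that are acyclic
cofibrations.
-/

open scoped ZeroObject

namespace WaldLoc

/-! ### Cokernels of maps of exact sequences -/

section Abelian

variable {𝒜 : Type u} [Category.{v} 𝒜] [Abelian 𝒜]

/-- Componentwise cokernels of a monomorphism of short exact sequences form a short exact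
sequence: the connecting map of the snake lemma starts at the kernel of `φ.τ₃`, which is zero. -/
theorem shortExact_cokernels {S₁ S₂ : ShortComplex 𝒜} (h₁ : S₁.ShortExact)
    (h₂ : S₂.ShortExact) (φ : S₁ ⟶ S₂) {T : ShortComplex 𝒜} (ψ : S₂ ⟶ T)
    (w₁ : φ.τ₁ ≫ ψ.τ₁ = 0) (w₂ : φ.τ₂ ≫ ψ.τ₂ = 0) (w₃ : φ.τ₃ ≫ ψ.τ₃ = 0)
    (e₁ : (ShortComplex.mk φ.τ₁ ψ.τ₁ w₁).ShortExact)
    (e₂ : (ShortComplex.mk φ.τ₂ ψ.τ₂ w₂).ShortExact)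
    (e₃ : (ShortComplex.mk φ.τ₃ ψ.τ₃ w₃).ShortExact) : T.ShortExact := by
  have w : φ ≫ ψ = 0 := by ext <;> assumption
  let D : ShortComplex.SnakeInput 𝒜 :=
    { L₀ := kernel φ
      L₁ := S₁
      L₂ := S₂
      L₃ := T
      v₀₁ := kernel.ι φ
      v₁₂ := φ
      v₂₃ := ψ
      w₀₂ := kernel.condition φ
      w₁₃ := w
      h₀ := kernelIsKernel φ
      h₃ := by
        apply ShortComplex.isColimitOfIsColimitπ
        · exact (CokernelCofork.isColimitMapCoconeEquiv _ ShortComplex.π₁).symm e₁.gIsCokernel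
        · exact (CokernelCofork.isColimitMapCoconeEquiv _ ShortComplex.π₂).symm e₂.gIsCokernel
        · exact (CokernelCofork.isColimitMapCoconeEquiv _ ShortComplex.π₃).symm e₃.gIsCokernel
      L₁_exact := h₁.exact
      epi_L₁_g := h₁.epi_g
      L₂_exact := h₂.exact
      mono_L₂_f := h₂.mono_f }
  have hz : D.δ = 0 := by
    have := e₃.mono_f
    dsimp at this
    have h0 : D.v₀₁.τ₃ = 0 := by
      have h := D.w₀₂_τ₃
      have : Mono D.v₁₂.τ₃ := this
      rwa [← cancel_mono D.v₁₂.τ₃, zero_comp]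
    have h1 : 𝟙 D.L₀.X₃ = 0 := Fork.IsLimit.hom_ext D.h₀τ₃ (by simp [h0])
    rw [← Category.id_comp D.δ, h1, zero_comp]
  refine ShortComplex.ShortExact.mk' D.L₃_exact ?_ ?_
  · exact (ShortComplex.exact_iff_mono _ hz).1 D.L₂'_exact
  · have : Epi ψ.τ₃ := e₃.epi_g
    have := h₂.epi_g
    have : Epi (ψ.τ₂ ≫ T.g) := by
      rw [ψ.comm₂₃]; exact epi_comp _ _
    exact epi_of_epi ψ.τ₂ T.g

end Abelian

section Exact

variable {B : Type u} [Category.{v} B] [Preadditive B] {E : ObjectProperty (ShortComplex B)}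

namespace IsExactCategory

theorem of_iso (hE : IsExactCategory.{w, w'} E) {X Y Q X' Y' Q' : B} {i : X ⟶ Y} {p : Y ⟶ Q}
    {w : i ≫ p = 0} (h : E (ShortComplex.mk i p w)) {i' : X' ⟶ Y'} {p' : Y' ⟶ Q'}
    {w' : i' ≫ p' = 0} (e₁ : X ≅ X') (e₂ : Y ≅ Y') (e₃ : Q ≅ Q')
    (hi : e₁.hom ≫ i' = i ≫ e₂.hom) (hp : e₂.hom ≫ p' = p ≫ e₃.hom) :
    E (ShortComplex.mk i' p' w') := by
  have e : ShortComplex.mk i p w ≅ ShortComplex.mk i' p' w' := ShortComplex.isoMk e₁ e₂ e₃ hi hp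
  obtain ⟨𝒜, _, _, ι, _, _, _, hS, -⟩ := hE
  exact (hS _).2 (ShortComplex.shortExact_of_iso (ι.mapShortComplex.mapIso e) ((hS _).1 h))

theorem of_splitting (hE : IsExactCategory.{w, w'} E) {S : ShortComplex B} (s : S.Splitting) :
    E S := by
  obtain ⟨𝒜, _, _, ι, _, _, _, hS, -⟩ := hE
  exact (hS S).2 (s.map ι).shortExact

/-- In an exact sequence of `B` the second map has the universal property of a cokernel in `B`,
because the embedding into the abelian category is fully faithful. -/
theorem exists_desc (hE : IsExactCategory.{w, w'} E) {X Y Q W : B} {i : X ⟶ Y} {p : Y ⟶ Q}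
    {w : i ≫ p = 0} (h : E (ShortComplex.mk i p w)) (k : Y ⟶ W) (hk : i ≫ k = 0) :
    ∃ l : Q ⟶ W, p ≫ l = k := by
  obtain ⟨𝒜, _, _, ι, _, _, _, hS, -⟩ := hE
  have h' := (hS _).1 h
  have : Epi (ι.map p) := h'.epi_g
  obtain ⟨l, hl⟩ : ∃ l : ι.obj Q ⟶ ι.obj W, ι.map p ≫ l = ι.map k :=
    ⟨_, (CokernelCofork.IsColimit.desc' h'.gIsCokernel (ι.map k) (by
      change ι.map i ≫ ι.map k = 0
      rw [← ι.map_comp, hk, ι.map_zero])).2⟩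
  exact ⟨ι.preimage l, ι.map_injective (by simpa using hl)⟩

theorem epi (hE : IsExactCategory.{w, w'} E) {X Y Q : B} {i : X ⟶ Y} {p : Y ⟶ Q}
    {w : i ≫ p = 0} (h : E (ShortComplex.mk i p w)) : Epi p := by
  obtain ⟨𝒜, _, _, ι, _, _, _, hS, -⟩ := hE
  have : Epi (ι.map p) := ((hS _).1 h).epi_g
  exact ι.epi_of_epi_map this

/-- The `3 × 3` lemma. The cokernel of the middle map is formed in the ambient abelian category,
where it is an extension of `C₃` by `C₁`, so it lies in `B`. In particular the middle map of a
map of exact sequences is an admissible monomorphism if the outer two are. -/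
theorem exists_cokernels (hE : IsExactCategory.{w, w'} E) {X₁ X₂ X₃ Y₁ Y₂ Y₃ C₁ C₃ : B}
    {f : X₁ ⟶ X₂} {g : X₂ ⟶ X₃} {w : f ≫ g = 0} (h : E (ShortComplex.mk f g w))
    {f' : Y₁ ⟶ Y₂} {g' : Y₂ ⟶ Y₃} {w' : f' ≫ g' = 0} (h' : E (ShortComplex.mk f' g' w'))
    {x₁ : X₁ ⟶ Y₁} {p₁ : Y₁ ⟶ C₁} {w₁ : x₁ ≫ p₁ = 0} (e₁ : E (ShortComplex.mk x₁ p₁ w₁))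
    {x₃ : X₃ ⟶ Y₃} {p₃ : Y₃ ⟶ C₃} {w₃ : x₃ ≫ p₃ = 0} (e₃ : E (ShortComplex.mk x₃ p₃ w₃))
    (x₂ : X₂ ⟶ Y₂) (hf : x₁ ≫ f' = f ≫ x₂) (hg : x₂ ≫ g' = g ≫ x₃) :
    ∃ (C₂ : B) (p₂ : Y₂ ⟶ C₂) (w₂ : x₂ ≫ p₂ = 0) (a : C₁ ⟶ C₂) (b : C₂ ⟶ C₃)
      (w : a ≫ b = 0), E (ShortComplex.mk x₂ p₂ w₂) ∧ E (ShortComplex.mk a b w) ∧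
      f' ≫ p₂ = p₁ ≫ a := by
  obtain ⟨𝒜, _, _, ι, _, _, _, hS, hext⟩ := hE
  have hS' : ∀ {X Y Z : B} {f : X ⟶ Y} {g : Y ⟶ Z} (w : f ≫ g = 0),
      E (ShortComplex.mk f g w) ↔ (ShortComplex.mk (ι.map f) (ι.map g)
        (by rw [← ι.map_comp, w, ι.map_zero])).ShortExact := fun _ => hS _
  rw [hS'] at h h' e₁ e₃
  have : Epi (ι.map p₁) := e₁.epi_g
  have hf' : ι.map x₁ ≫ ι.map f' = ι.map f ≫ ι.map x₂ := by rw [← ι.map_comp, hf, ι.map_comp]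
  have hg' : ι.map x₂ ≫ ι.map g' = ι.map g ≫ ι.map x₃ := by rw [← ι.map_comp, hg, ι.map_comp]
  let φ : ShortComplex.mk (ι.map f) (ι.map g) (by rw [← ι.map_comp, w, ι.map_zero]) ⟶
      ShortComplex.mk (ι.map f') (ι.map g') (by rw [← ι.map_comp, w', ι.map_zero]) :=
    ShortComplex.homMk (ι.map x₁) (ι.map x₂) (ι.map x₃) hf' hg'
  have hm₂ : Mono (ι.map x₂) := by
    have : Mono φ.τ₁ := e₁.mono_f
    have : Mono φ.τ₃ := e₃.mono_f
    have := h.mono_f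
    have := h'.mono_f
    exact ShortComplex.mono_τ₂_of_exact_of_mono φ h.exact
  have e₂ : (ShortComplex.mk (ι.map x₂) (cokernel.π (ι.map x₂))
      (cokernel.condition _)).ShortExact :=
    ShortComplex.ShortExact.mk' (ShortComplex.exact_cokernel _) hm₂ inferInstance
  obtain ⟨a', ha'⟩ : ∃ a' : ι.obj C₁ ⟶ cokernel (ι.map x₂),
      ι.map p₁ ≫ a' = ι.map f' ≫ cokernel.π (ι.map x₂) := by
    refine ⟨_, (CokernelCofork.IsColimit.desc' e₁.gIsCokernel
      (ι.map f' ≫ cokernel.π (ι.map x₂)) ?_).2⟩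
    change ι.map x₁ ≫ ι.map f' ≫ cokernel.π (ι.map x₂) = 0
    rw [← ι.map_comp_assoc, hf, ι.map_comp_assoc, cokernel.condition, comp_zero]
  obtain ⟨b', hb'⟩ : ∃ b' : cokernel (ι.map x₂) ⟶ ι.obj C₃,
      cokernel.π (ι.map x₂) ≫ b' = ι.map g' ≫ ι.map p₃ := by
    refine ⟨cokernel.desc _ (ι.map g' ≫ ι.map p₃) ?_, cokernel.π_desc _ _ _⟩
    rw [← ι.map_comp, ← ι.map_comp, reassoc_of% hg, w₃, comp_zero, ι.map_zero]
  have wab : a' ≫ b' = 0 := by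
    rw [← cancel_epi (ι.map p₁), reassoc_of% ha', hb', ← ι.map_comp_assoc, w', ι.map_zero,
      zero_comp, comp_zero]
  have eT : (ShortComplex.mk a' b' wab).ShortExact :=
    shortExact_cokernels h h' φ
      (ShortComplex.homMk (ι.map p₁) (cokernel.π (ι.map x₂)) (ι.map p₃) ha' hb')
      _ _ _ e₁ e₂ e₃
  obtain ⟨C₂, ⟨e⟩⟩ := hext _ eT ⟨C₁, ⟨Iso.refl _⟩⟩ ⟨C₃, ⟨Iso.refl _⟩⟩
  change ι.obj C₂ ≅ cokernel (ι.map x₂) at e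
  refine ⟨C₂, ι.preimage (cokernel.π _ ≫ e.inv), ι.map_injective (by simp),
    ι.preimage (a' ≫ e.inv), ι.preimage (e.hom ≫ b'), ι.map_injective (by simp [wab]), ?_, ?_,
    ι.map_injective (by simp [reassoc_of% ha'])⟩
  · rw [hS']
    refine ShortComplex.shortExact_of_iso ?_ e₂
    exact ShortComplex.isoMk (Iso.refl _) (Iso.refl _) e.symm (by simp) (by simp)
  · rw [hS']
    refine ShortComplex.shortExact_of_iso ?_ eT
    exact ShortComplex.isoMk (Iso.refl _) e.symm (Iso.refl _) (by simp) (by simp)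

end IsExactCategory
end Exact

/-! ### Exact categories: biproducts, composites and pushouts -/

section Exact

variable {B : Type u} [Category.{v} B] [Preadditive B]
  {E : ObjectProperty (ShortComplex B)}

theorem isPushout_of_isColimit {X Y Q Z : B} {i : X ⟶ Y} {p : Y ⟶ Q} {w : i ≫ p = 0}
    (h : IsColimit (CokernelCofork.ofπ p w)) (hZ : IsZero Z) :
    IsPushout i (0 : X ⟶ Z) p 0 := by
  refine ⟨⟨by simp [w]⟩, ⟨PushoutCocone.IsColimit.mk _
    (fun s => h.desc (CokernelCofork.ofπ s.inl ?_)) ?_ ?_ ?_⟩⟩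
  · simp [s.condition]
  · intro s
    exact h.fac _ .one
  · intro s
    exact hZ.eq_of_src _ _
  · intro s m hm _
    exact Cofork.IsColimit.hom_ext h (hm.trans (h.fac (CokernelCofork.ofπ s.inl _) .one).symm)

/-- A pushout along a map to a zero object is a cokernel. -/
noncomputable def isColimitOfIsPushout {X Y Q Z : B} {i : X ⟶ Y} {a : X ⟶ Z} {p : Y ⟶ Q}
    {b : Z ⟶ Q} (h : IsPushout i a p b) (hZ : IsZero Z) (w : i ≫ p = 0) :
    IsColimit (CokernelCofork.ofπ p w) :=
  CokernelCofork.IsColimit.ofπ p w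
    (fun k hk => h.desc k 0 (by simp [hk]))
    (fun k hk => h.inl_desc _ _ _)
    (fun k hk m hm => h.hom_ext (by rw [hm, h.inl_desc]) (hZ.eq_of_src _ _))

/-- The direct sum of two cokernels is a cokernel of the direct sum. -/
noncomputable def isColimitBiprodMap [HasBinaryBiproducts B]
    {X Y Q X' Y' Q' : B} {i : X ⟶ Y} {p : Y ⟶ Q} {w : i ≫ p = 0}
    {i' : X' ⟶ Y'} {p' : Y' ⟶ Q'} {w' : i' ≫ p' = 0}
    (h : IsColimit (CokernelCofork.ofπ p w)) (h' : IsColimit (CokernelCofork.ofπ p' w')) :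
    IsColimit (CokernelCofork.ofπ (f := biprod.map i i') (biprod.map p p')
      (by ext <;> simp [w, w'])) :=
  CokernelCofork.IsColimit.ofπ _ _
    (fun k hk => biprod.desc
      (h.desc (CokernelCofork.ofπ (biprod.inl ≫ k) (by simpa using biprod.inl ≫= hk)))
      (h'.desc (CokernelCofork.ofπ (biprod.inr ≫ k) (by simpa using biprod.inr ≫= hk))))
    (fun k hk => by
      ext
      · simpa using h.fac (CokernelCofork.ofπ (biprod.inl ≫ k) _) .one
      · simpa using h'.fac (CokernelCofork.ofπ (biprod.inr ≫ k) _) .one)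
    (fun k hk m hm => by
      ext
      · refine Cofork.IsColimit.hom_ext h ?_
        have := h.fac (CokernelCofork.ofπ (biprod.inl ≫ k) (by simpa using biprod.inl ≫= hk))
          .one
        simp at this
        simp [this, ← hm]
      · refine Cofork.IsColimit.hom_ext h' ?_
        have := h'.fac (CokernelCofork.ofπ (biprod.inr ≫ k) (by simpa using biprod.inr ≫= hk))
          .one
        simp at this
        simp [this, ← hm])

namespace IsExactCategory

theorem nonempty_isColimit (hE : IsExactCategory.{w, w'} E)
    {X Y Q : B} {i : X ⟶ Y} {p : Y ⟶ Q} {w : i ≫ p = 0}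
    (h : E (ShortComplex.mk i p w)) : Nonempty (IsColimit (CokernelCofork.ofπ p w)) := by
  have : Epi p := hE.epi h
  exact ⟨CokernelCofork.IsColimit.ofπ' p w fun k hk =>
    ⟨(hE.exists_desc h k hk).choose, (hE.exists_desc h k hk).choose_spec⟩⟩

/-- Whether a pair `(i, p)` is exact depends only on `i`, if `p` is a cokernel of `i` in `B`. -/
theorem of_isColimit (hE : IsExactCategory.{w, w'} E)
    {X Y Q Q' : B} {i : X ⟶ Y} {p : Y ⟶ Q} {w : i ≫ p = 0}
    (h : E (ShortComplex.mk i p w)) {p' : Y ⟶ Q'} {w' : i ≫ p' = 0}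
    (h' : IsColimit (CokernelCofork.ofπ p' w')) : E (ShortComplex.mk i p' w') := by
  obtain ⟨hp⟩ := hE.nonempty_isColimit h
  refine hE.of_iso h (Iso.refl _) (Iso.refl _) (hp.coconePointUniqueUpToIso h') (by simp) ?_
  simpa using (hp.comp_coconePointUniqueUpToIso_hom h' .one).symm

theorem of_isIso_of_isZero (hE : IsExactCategory.{w, w'} E)
    {X Y Z : B} (f : X ⟶ Y) [IsIso f] (hZ : IsZero Z) :
    E (ShortComplex.mk f (0 : Y ⟶ Z) comp_zero) :=
  hE.of_splitting { r := inv f, s := 0, s_g := hZ.eq_of_src _ _ }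

theorem of_isZero_of_isIso (hE : IsExactCategory.{w, w'} E)
    {X Y Z : B} (f : Z ⟶ X) (g : X ⟶ Y) [IsIso g] (hZ : IsZero Z) :
    E (ShortComplex.mk f g (hZ.eq_of_src _ _)) :=
  hE.of_splitting
    { r := 0, s := inv g, f_r := hZ.eq_of_src _ _, s_g := by simp, id := by simp }

theorem of_comp_iso (hE : IsExactCategory.{w, w'} E) {X Y Y' Q : B} {i : X ⟶ Y} {p : Y ⟶ Q}
    {w : i ≫ p = 0} (h : E (ShortComplex.mk i p w)) (e : Y ≅ Y') {i' : X ⟶ Y'}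
    (he : i ≫ e.hom = i') : E (ShortComplex.mk i' (e.inv ≫ p) (by simp [← he, w])) :=
  hE.of_iso h (Iso.refl _) e (Iso.refl _) (by simp [he]) (by simp)

/-- A retraction of an admissible monomorphism extends to a splitting, with no idempotent
completeness of `B` assumed. -/
theorem exists_splitting (hE : IsExactCategory.{w, w'} E)
    {X Y Q : B} {i : X ⟶ Y} {p : Y ⟶ Q} {w : i ≫ p = 0}
    (h : E (ShortComplex.mk i p w)) (r : Y ⟶ X) (hr : i ≫ r = 𝟙 X) :
    ∃ s : (ShortComplex.mk i p w).Splitting, s.r = r := by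
  obtain ⟨s, hs⟩ := hE.exists_desc h (𝟙 Y - r ≫ i) (by simp [reassoc_of% hr])
  have : Epi p := hE.epi h
  change Q ⟶ Y at s
  change p ≫ s = _ at hs
  refine ⟨{ r := r, s := s, f_r := hr, s_g := ?_, id := by simp [hs] }, rfl⟩
  dsimp
  rw [← cancel_epi p, reassoc_of% hs]
  simp [w]


theorem inl_snd [HasBinaryBiproducts B] (hE : IsExactCategory.{w, w'} E) (X Y : B) :
    E (ShortComplex.mk (biprod.inl : X ⟶ X ⊞ Y) biprod.snd (by simp)) :=
  hE.of_splitting { r := biprod.fst, s := biprod.inr, id := by simp }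

theorem inr_fst [HasBinaryBiproducts B] (hE : IsExactCategory.{w, w'} E) (X Y : B) :
    E (ShortComplex.mk (biprod.inr : Y ⟶ X ⊞ Y) biprod.fst (by simp)) :=
  hE.of_splitting { r := biprod.snd, s := biprod.inl, id := by ext <;> simp }

/-- The cokernel of a composite of admissible monomorphisms is an extension of the two cokernels:
this is the `3 × 3` lemma for the map from `X = X → 0` to `Y → Z → D`. -/
theorem exists_comp [HasZeroObject B] (hE : IsExactCategory.{w, w'} E)
    {X Y Z C D : B} {i : X ⟶ Y} {p : Y ⟶ C} {w : i ≫ p = 0} {j : Y ⟶ Z}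
    {q : Z ⟶ D} {w' : j ≫ q = 0} (h : E (ShortComplex.mk i p w))
    (h' : E (ShortComplex.mk j q w')) :
    ∃ (K : B) (r : Z ⟶ K) (wr : (i ≫ j) ≫ r = 0) (a : C ⟶ K) (b : K ⟶ D) (wab : a ≫ b = 0),
      E (ShortComplex.mk (i ≫ j) r wr) ∧ E (ShortComplex.mk a b wab) := by
  obtain ⟨K, r, wr, a, b, wab, h₁, h₂, -⟩ := hE.exists_cokernels
    (hE.of_isIso_of_isZero (𝟙 X) (isZero_zero B)) h'
    h (hE.of_isZero_of_isIso (0 : (0 : B) ⟶ D) (𝟙 D) (isZero_zero B)) (i ≫ j) (by simp)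
    (by simp [w'])
  exact ⟨K, r, wr, a, b, wab, h₁, h₂⟩

/-- Exact sequences are closed under direct sums. -/
theorem biprod_map [HasZeroObject B] [HasBinaryBiproducts B] (hE : IsExactCategory.{w, w'} E)
    {X Y Q X' Y' Q' : B} {i : X ⟶ Y} {p : Y ⟶ Q} {w : i ≫ p = 0}
    {i' : X' ⟶ Y'} {p' : Y' ⟶ Q'} {w' : i' ≫ p' = 0}
    (h : E (ShortComplex.mk i p w)) (h' : E (ShortComplex.mk i' p' w')) :
    E (ShortComplex.mk (biprod.map i i') (biprod.map p p') (by ext <;> simp [w, w'])) := by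
  obtain ⟨K, r, wr, -, -, -, h₁, -⟩ := hE.exists_cokernels
    (hE.inl_snd X X') (hE.inl_snd Y Y')
    h h' (biprod.map i i') (by simp) (by simp)
  obtain ⟨hp⟩ := hE.nonempty_isColimit h
  obtain ⟨hp'⟩ := hE.nonempty_isColimit h'
  exact hE.of_isColimit h₁ (isColimitBiprodMap hp hp')

/-- If `i` is an admissible monomorphism, so is `(i, g)`, and the cokernel of `(i, g)` is an
extension of that of `i` by `Z`. This is the `3 × 3` lemma for the map from `0 → X = X` to
`Z → Y ⊞ Z → Y`. -/
theorem exists_cokernel_lift [HasZeroObject B] [HasBinaryBiproducts B]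
    (hE : IsExactCategory.{w, w'} E)
    {X Y Q Z : B} {i : X ⟶ Y} {p : Y ⟶ Q} {w : i ≫ p = 0}
    (h : E (ShortComplex.mk i p w)) (g : X ⟶ Z) :
    ∃ (K : B) (r : Y ⊞ Z ⟶ K) (wr : biprod.lift i g ≫ r = 0) (b : K ⟶ Q)
      (wb : (biprod.inr ≫ r) ≫ b = 0),
      E (ShortComplex.mk (biprod.lift i g) r wr) ∧ E (ShortComplex.mk (biprod.inr ≫ r) b wb) := by
  obtain ⟨K, r, wr, a, b, wab, h₁, h₂, ha⟩ := hE.exists_cokernels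
    (hE.of_isZero_of_isIso (0 : (0 : B) ⟶ X) (𝟙 X) (isZero_zero B)) (hE.inr_fst Y Z)
    (hE.of_isZero_of_isIso (0 : (0 : B) ⟶ Z) (𝟙 Z) (isZero_zero B)) h (biprod.lift i g) (by simp)
    (by simp)
  obtain rfl : biprod.inr ≫ r = a := by simpa using ha
  exact ⟨K, r, wr, b, wab, h₁, h₂⟩

theorem admMono_lift_right [HasZeroObject B] [HasBinaryBiproducts B]
    (hE : IsExactCategory.{w, w'} E)
    {X Y Z : B} (f : X ⟶ Y) {g : X ⟶ Z} (hg : admMono E g) :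
    admMono E (biprod.lift f g) := by
  obtain ⟨Q, p, w, h⟩ := hg
  obtain ⟨K, r, wr, -, -, h₁, -⟩ := hE.exists_cokernel_lift h f
  exact ⟨K, _, _, hE.of_comp_iso h₁ (biprod.braiding Z Y) (by ext <;> simp)⟩

/-- Pushouts along an admissible monomorphism `f` exist: they are the cokernels of `(f, -g)`. -/
theorem exists_isPushout [HasZeroObject B] [HasBinaryBiproducts B] (hE : IsExactCategory.{w, w'} E)
    {X Y Z : B} {f : X ⟶ Y} (hf : admMono E f) (g : X ⟶ Z) :
    ∃ (P : B) (inl : Y ⟶ P) (inr : Z ⟶ P), IsPushout f g inl inr ∧ admMono E inr ∧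
      ∃ w, E (ShortComplex.mk (biprod.lift f (-g)) (biprod.desc inl inr) w) := by
  obtain ⟨Q, p, w, h⟩ := hf
  obtain ⟨P, r, wr, b, wb, h₁, h₂⟩ := hE.exists_cokernel_lift h (-g)
  have hr : biprod.desc (biprod.inl ≫ r) (biprod.inr ≫ r) = r := by ext <;> simp
  have sq : CommSq f g (biprod.inl ≫ r) (biprod.inr ≫ r) := ⟨by
    rw [← sub_eq_zero, ← wr, biprod.lift_eq]
    simp [sub_eq_add_neg]⟩
  have h₁' : E sq.shortComplex := by
    simpa only [CommSq.shortComplex, hr] using h₁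
  obtain ⟨hc⟩ := hE.nonempty_isColimit h₁'
  exact ⟨P, _, _, ⟨sq, ⟨sq.isColimitEquivIsColimitCokernelCofork.symm hc⟩⟩, ⟨Q, b, wb, h₂⟩,
    sq.shortComplex.zero, h₁'⟩

theorem shortComplex_of_isPushout [HasZeroObject B] [HasBinaryBiproducts B]
    (hE : IsExactCategory.{w, w'} E)
    {X Y Z P : B} {f : X ⟶ Y} {g : X ⟶ Z} {inl : Y ⟶ P}
    {inr : Z ⟶ P} (hf : admMono E f) (h : IsPushout f g inl inr) : E h.shortComplex := by
  obtain ⟨P', inl', inr', h', -, w, hw⟩ := hE.exists_isPushout hf g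
  exact hE.of_isColimit hw h.isColimitCokernelCofork

theorem admMono_comp [HasZeroObject B] (hE : IsExactCategory.{w, w'} E)
    {X Y Z : B} {i : X ⟶ Y} {j : Y ⟶ Z} (hi : admMono E i)
    (hj : admMono E j) : admMono E (i ≫ j) := by
  obtain ⟨_, _, _, hi⟩ := hi
  obtain ⟨_, _, _, hj⟩ := hj
  obtain ⟨K, r, wr, -, -, -, h, -⟩ := hE.exists_comp hi hj
  exact ⟨K, r, wr, h⟩

theorem admMono_of_isIso [HasZeroObject B] (hE : IsExactCategory.{w, w'} E)
    {X Y : B} (f : X ⟶ Y) [IsIso f] : admMono E f :=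
  ⟨_, _, _, hE.of_isIso_of_isZero f (isZero_zero B)⟩

theorem admMono_of_isZero (hE : IsExactCategory.{w, w'} E)
    {X Z : B} (f : Z ⟶ X) (hZ : IsZero Z) : admMono E f :=
  ⟨_, _, _, hE.of_isZero_of_isIso f (𝟙 X) hZ⟩

theorem admMono_of_isPushout [HasZeroObject B] [HasBinaryBiproducts B]
    (hE : IsExactCategory.{w, w'} E)
    {X Y Z P : B} {f : X ⟶ Y} {g : X ⟶ Z} {inl : Y ⟶ P}
    {inr : Z ⟶ P} (hf : admMono E f) (h : IsPushout f g inl inr) : admMono E inr := by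
  obtain ⟨P', inl', inr', h', hinr, -⟩ := hE.exists_isPushout hf g
  rw [← h'.inr_isoIsPushout_hom (h' := h)]
  exact hE.admMono_comp hinr (hE.admMono_of_isIso _)

theorem shortComplex_of_isCofSeq (hE : IsExactCategory.{w, w'} E)
    {W : CofWeq B} (hW : W.cof = admMono E) {X Y Q : B} {i : X ⟶ Y}
    {p : Y ⟶ Q} (h : W.IsCofSeq i p) : ∃ w, E (ShortComplex.mk i p w) := by
  obtain ⟨hi, Z, a, b, hZ, hp⟩ := h
  rw [hW] at hi
  obtain ⟨Q', q, w', hq⟩ := hi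
  have w : i ≫ p = 0 := by rw [hp.w, hZ.eq_of_tgt a 0, zero_comp]
  exact ⟨w, hE.of_isColimit hq (isColimitOfIsPushout hp hZ w)⟩

/-- With `shortComplex_of_isCofSeq`: the cofibration sequences of a structure whose cofibrations
are the admissible monomorphisms are the exact sequences. -/
theorem isCofSeq [HasZeroObject B] (hE : IsExactCategory.{w, w'} E)
    {W : CofWeq B} (hW : W.cof = admMono E) {X Y Q : B} {i : X ⟶ Y}
    {p : Y ⟶ Q} {w : i ≫ p = 0} (h : E (ShortComplex.mk i p w)) : W.IsCofSeq i p := by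
  obtain ⟨hp⟩ := hE.nonempty_isColimit h
  exact ⟨hW ▸ ⟨Q, p, w, h⟩, 0, 0, 0, isZero_zero B, isPushout_of_isColimit hp (isZero_zero B)⟩

end IsExactCategory
end Exact

/-! ### The weak equivalences of the localized structure -/

theorem IsExactFunctor.map_isCofSeq {B : Type u} [Category.{v} B] {C : Type u'} [Category.{v'} C]
    {V : CofWeq B} {W : CofWeq C} {F : B ⥤ C} (hF : IsExactFunctor V W F) {X Y Q : B} {i : X ⟶ Y}
    {p : Y ⟶ Q} (h : V.IsCofSeq i p) : W.IsCofSeq (F.map i) (F.map p) := by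
  obtain ⟨hi, Z, a, b, hZ, hp⟩ := h
  exact ⟨hF.map_cof i hi, F.obj Z, F.map a, F.map b, hF.map_isZero hZ, hF.map_isPushout hp hi⟩

section Localization

variable {B : Type u} [Category.{v} B] [Preadditive B]
  {E : ObjectProperty (ShortComplex B)} {A : ObjectProperty B}

theorem isInj_of_isZero {Z : B} (hZ : IsZero Z) : IsInj E Z :=
  fun _ _ _ => ⟨0, hZ.eq_of_tgt _ _⟩

theorem IsInj.biprod [HasBinaryBiproducts B] {I J : B} (hI : IsInj E I) (hJ : IsInj E J) :
    IsInj E (I ⊞ J) := by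
  intro X Y i hi f
  obtain ⟨g, hg⟩ := hI i hi (f ≫ biprod.fst)
  obtain ⟨g', hg'⟩ := hJ i hi (f ≫ biprod.snd)
  exact ⟨biprod.lift g g', by ext <;> simp [hg, hg']⟩

theorem TwoOutOfThree.left_iff_middle (hA : TwoOutOfThree E A) {X Y Q : B} {i : X ⟶ Y}
    {p : Y ⟶ Q} {w : i ≫ p = 0} (h : E (ShortComplex.mk i p w)) (hQ : A Q) : A X ↔ A Y :=
  ⟨fun hX => (hA _ h).2.1 hX hQ, fun hY => (hA _ h).2.2 hY hQ⟩

theorem TwoOutOfThree.middle_iff_right (hA : TwoOutOfThree E A) {X Y Q : B} {i : X ⟶ Y}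
    {p : Y ⟶ Q} {w : i ≫ p = 0} (h : E (ShortComplex.mk i p w)) (hX : A X) : A Y ↔ A Q :=
  ⟨fun hY => (hA _ h).1 hX hY, fun hQ => (hA _ h).2.1 hX hQ⟩

theorem TwoOutOfThree.mem_of_iso [HasZeroObject B] (hE : IsExactCategory.{w, w'} E)
    (hA : TwoOutOfThree E A) (hAinj : ∀ I : B, IsInj E I → A I) {X Y : B} (e : X ≅ Y)
    (hX : A X) : A Y :=
  (hA.left_iff_middle (hE.of_isIso_of_isZero e.hom (isZero_zero B))
    (hAinj _ (isInj_of_isZero (isZero_zero B)))).1 hX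

/-- Whether an admissible monomorphism is acyclic can be read off from any of its cokernels. -/
theorem acyclicCof_iff [HasZeroObject B] (hE : IsExactCategory.{w, w'} E)
    (hA : TwoOutOfThree E A) (hAinj : ∀ I : B, IsInj E I → A I) {X Y Q : B} {i : X ⟶ Y}
    {p : Y ⟶ Q} {w : i ≫ p = 0} (h : E (ShortComplex.mk i p w)) :
    acyclicCof E A i ↔ A Q := by
  refine ⟨?_, fun hQ => ⟨Q, p, w, h, hQ⟩⟩
  rintro ⟨Q', p', w', h', hQ'⟩
  obtain ⟨hp⟩ := hE.nonempty_isColimit h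
  obtain ⟨hp'⟩ := hE.nonempty_isColimit h'
  exact hA.mem_of_iso hE hAinj (hp'.coconePointUniqueUpToIso hp) hQ'

theorem weq_of_isIso [HasZeroObject B] (hE : IsExactCategory.{w, w'} E)
    (hAinj : ∀ I : B, IsInj E I → A I) {X Y : B} (f : X ⟶ Y) [IsIso f] :
    (locCofWeq E A).weq f :=
  ⟨Y, f, 𝟙 Y, ⟨_, _, _, hE.of_isIso_of_isZero f (isZero_zero B),
    hAinj _ (isInj_of_isZero (isZero_zero B))⟩,
    ⟨_, _, _, hE.of_isZero_of_isIso (0 : (0 : B) ⟶ Y) (𝟙 Y) (isZero_zero B),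
      isInj_of_isZero (isZero_zero B)⟩, Category.comp_id f⟩

/-- An acyclic fibration splits, since its kernel is injective. So a factorization of `f` as an
acyclic cofibration followed by an acyclic fibration has the middle object `Y ⊞ I`. -/
theorem exists_acyclicCof_lift_of_weq [HasBinaryBiproducts B]
    (hE : IsExactCategory.{w, w'} E) {X Y : B} {f : X ⟶ Y}
    (hf : (locCofWeq E A).weq f) :
    ∃ (I : B) (g : X ⟶ I), IsInj E I ∧ acyclicCof E A (biprod.lift f g) := by
  obtain ⟨M, i, p, ⟨Q, q, w, hi, hQ⟩, ⟨I, k, w', hp, hI⟩, rfl⟩ := hf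
  obtain ⟨r, hr⟩ := hI k ⟨Y, p, w', hp⟩ (𝟙 I)
  obtain ⟨s, rfl⟩ := hE.exists_splitting hp r hr
  have hpr := s.id
  have hps := s.s_g
  have hsr := s.s_r
  dsimp at hpr hps hsr
  let e : M ≅ Y ⊞ I :=
    { hom := biprod.lift p s.r
      inv := biprod.desc s.s k
      hom_inv_id := by rw [biprod.lift_desc, add_comm]; exact hpr
      inv_hom_id := by ext <;> simp [hps, hsr, w', hr] }
  exact ⟨I, i ≫ s.r, hI, Q, _, _, hE.of_comp_iso hi e (by ext <;> simp [e]), hQ⟩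

section

variable [HasZeroObject B] [HasBinaryBiproducts B]

/-- The criterion for weak equivalences. For any map `g` to an injective object for which
`(f, g)` is an admissible monomorphism, `f` is a weak equivalence if and only if the cokernel of
`(f, g)` is in `A`. -/
theorem weq_iff (hE : IsExactCategory.{w, w'} E) (hA : TwoOutOfThree E A)
    (hAinj : ∀ I : B, IsInj E I → A I) {X Y I C : B} {f : X ⟶ Y} {g : X ⟶ I} {c : Y ⊞ I ⟶ C}
    {w : biprod.lift f g ≫ c = 0} (hI : IsInj E I)
    (h : E (ShortComplex.mk (biprod.lift f g) c w)) : (locCofWeq E A).weq f ↔ A C := by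
  refine ⟨fun hf => ?_, fun hC => ?_⟩
  · obtain ⟨J, g', hJ, C', c', w', h', hC'⟩ := exists_acyclicCof_lift_of_weq hE hf
    -- Two such maps `g` and `g'` are compared through `(f, g, g')`, whose cokernel is an extension
    -- of either of the two cokernels by an injective object.
    obtain ⟨D', r', _, b', _, h₁', h₂'⟩ := hE.exists_cokernel_lift h' g
    obtain ⟨D, r, _, b, _, h₁, h₂⟩ := hE.exists_cokernel_lift h g'
    have hD' : A D' := (hA.middle_iff_right h₂' (hAinj I hI)).2 hC'
    let e : (Y ⊞ J) ⊞ I ≅ (Y ⊞ I) ⊞ J :=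
      { hom := biprod.lift (biprod.map biprod.fst (𝟙 I)) (biprod.fst ≫ biprod.snd)
        inv := biprod.lift (biprod.map biprod.fst (𝟙 J)) (biprod.fst ≫ biprod.snd)
        hom_inv_id := by ext <;> simp
        inv_hom_id := by ext <;> simp }
    have hD : A D :=
      (acyclicCof_iff hE hA hAinj h₁).1
        ⟨D', _, _, hE.of_comp_iso h₁' e (by ext <;> simp [e]), hD'⟩
    exact (hA.middle_iff_right h₂ (hAinj J hJ)).1 hD
  · exact ⟨Y ⊞ I, biprod.lift f g, biprod.fst, ⟨C, c, w, h, hC⟩, ⟨I, biprod.inr, _,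
      hE.inr_fst Y I, hI⟩, biprod.lift_fst _ _⟩

/-- A map of exact sequences has an exact sequence of mapping cones `C₁ → C₂ → C₃`, which detect
whether its components are weak equivalences. So if two components are, the third is too. -/
theorem exists_weq_iff (hE : IsExactCategory.{w, w'} E) (hinj : EnoughInj E)
    (hA : TwoOutOfThree E A) (hAinj : ∀ I : B, IsInj E I → A I) {X₁ X₂ X₃ Y₁ Y₂ Y₃ : B}
    {f : X₁ ⟶ X₂} {g : X₂ ⟶ X₃} {w : f ≫ g = 0} (h : E (ShortComplex.mk f g w))
    {f' : Y₁ ⟶ Y₂} {g' : Y₂ ⟶ Y₃} {w' : f' ≫ g' = 0} (h' : E (ShortComplex.mk f' g' w'))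
    (x₁ : X₁ ⟶ Y₁) (x₂ : X₂ ⟶ Y₂) (x₃ : X₃ ⟶ Y₃) (hf : x₁ ≫ f' = f ≫ x₂)
    (hg : x₂ ≫ g' = g ≫ x₃) :
    ∃ (C₁ C₂ C₃ : B) (a : C₁ ⟶ C₂) (b : C₂ ⟶ C₃) (w : a ≫ b = 0),
      E (ShortComplex.mk a b w) ∧ ((locCofWeq E A).weq x₁ ↔ A C₁) ∧
      ((locCofWeq E A).weq x₂ ↔ A C₂) ∧ ((locCofWeq E A).weq x₃ ↔ A C₃) := by
  obtain ⟨I, i, hI, hi⟩ := hinj X₁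
  obtain ⟨J, j, hJ, hj⟩ := hinj X₃
  -- As in the horseshoe lemma, `(k, g ≫ j)` maps the middle object into `I ⊞ J`.
  obtain ⟨k, hk⟩ := hI f ⟨_, _, _, h⟩ i
  obtain ⟨C₁, p₁, w₁, h₁⟩ := hE.admMono_lift_right x₁ hi
  obtain ⟨C₃, p₃, w₃, h₃⟩ := hE.admMono_lift_right x₃ hj
  obtain ⟨C₂, p₂, w₂, a, b, wab, h₂, hab, -⟩ := hE.exists_cokernels h
    (hE.biprod_map h' (hE.inl_snd I J)) h₁ h₃ (biprod.lift x₂ (biprod.lift k (g ≫ j)))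
    (by ext <;> simp [hf, hk, reassoc_of% w]) (by ext <;> simp [hg])
  exact ⟨C₁, C₂, C₃, a, b, wab, hab, weq_iff hE hA hAinj hI h₁,
    weq_iff hE hA hAinj (hI.biprod hJ) h₂, weq_iff hE hA hAinj hJ h₃⟩

/-- The cones of `f`, `f ≫ g` and `g` form an exact sequence, namely the one attached to the
composite of `(f, a) : X ⟶ Y ⊞ I` and `(g, b) ⊞ 𝟙 : Y ⊞ I ⟶ (Z ⊞ J) ⊞ I`. -/
theorem locCofWeq_saturationAxiom (hE : IsExactCategory.{w, w'} E) (hinj : EnoughInj E)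
    (hA : TwoOutOfThree E A) (hAinj : ∀ I : B, IsInj E I → A I) :
    (locCofWeq E A).SaturationAxiom := by
  intro X Y Z f g
  obtain ⟨I, a, hI, ha⟩ := hinj X
  obtain ⟨J, b, hJ, hb⟩ := hinj Y
  obtain ⟨C, p, w, h⟩ := hE.admMono_lift_right f ha
  obtain ⟨D, q, w', h'⟩ := hE.admMono_lift_right g hb
  have h0 := hE.of_isIso_of_isZero (𝟙 I) (isZero_zero B)
  obtain ⟨K, r, wr, u, v, wuv, hr, huv⟩ := hE.exists_comp h (hE.biprod_map h' h0)
  have hr' := hE.of_comp_iso hr (biprod.associator Z J I)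
    (i' := biprod.lift (f ≫ g) (biprod.lift (f ≫ b) a)) (by ext <;> simp)
  have hD := hA.left_iff_middle (hE.inl_snd D 0)
    (hAinj _ (isInj_of_isZero (isZero_zero B)))
  rw [weq_iff hE hA hAinj hI h, weq_iff hE hA hAinj hJ h',
    weq_iff hE hA hAinj (hJ.biprod hI) hr', hD]
  exact ⟨(hA _ huv).2.1, (hA _ huv).1, fun hD hK => (hA _ huv).2.2 hK hD⟩

theorem locCofWeq_extensionAxiom (hE : IsExactCategory.{w, w'} E) (hinj : EnoughInj E)
    (hA : TwoOutOfThree E A) (hAinj : ∀ I : B, IsInj E I → A I) :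
    (locCofWeq E A).ExtensionAxiom := by
  intro X Y Q X' Y' Q' i p i' p' a b c h h' hi hp ha hc
  obtain ⟨w, h⟩ := hE.shortComplex_of_isCofSeq rfl h
  obtain ⟨w', h'⟩ := hE.shortComplex_of_isCofSeq rfl h'
  obtain ⟨C₁, C₂, C₃, u, v, wuv, huv, h₁, h₂, h₃⟩ :=
    exists_weq_iff hE hinj hA hAinj h h' a b c hi.symm hp.symm
  exact h₂.2 ((hA _ huv).2.1 (h₁.1 ha) (h₃.1 hc))

/-! ### The Waldhausen structures -/

/-- The axioms that concern only the cofibrations hold for the admissible monomorphisms, so that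
a choice of weak equivalences needs only the remaining axioms. -/
theorem isWaldhausen_of_admMono (hE : IsExactCategory.{w, w'} E) (W : CofWeq B)
    (hW : W.cof = admMono E) (hmul : W.weq.IsMultiplicative)
    (hiso : ∀ {X Y : B} (f : X ⟶ Y), IsIso f → W.weq f)
    (hglue : ∀ {X Y Z P X' Y' Z' P' : B}
      {i : X ⟶ Y} {j : X ⟶ Z} {inl : Y ⟶ P} {inr : Z ⟶ P}
      {i' : X' ⟶ Y'} {j' : X' ⟶ Z'} {inl' : Y' ⟶ P'} {inr' : Z' ⟶ P'}
      (x : X ⟶ X') (y : Y ⟶ Y') (z : Z ⟶ Z') (φ : P ⟶ P'),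
      IsPushout i j inl inr → IsPushout i' j' inl' inr' →
      admMono E i → admMono E i' → W.weq x → W.weq y → W.weq z →
      i ≫ y = x ≫ i' → j ≫ z = x ≫ j' →
      inl ≫ φ = y ≫ inl' → inr ≫ φ = z ≫ inr' → W.weq φ) : W.IsWaldhausen where
  hasZeroObject := inferInstance
  cof_mul :=
    { id_mem := fun X => hW ▸ hE.admMono_of_isIso (𝟙 X)
      comp_mem := fun f g hf hg => by
        rw [hW] at hf hg ⊢
        exact hE.admMono_comp hf hg }
  weq_mul := hmul
  cof_of_isIso f _ := hW ▸ hE.admMono_of_isIso f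
  cof_of_isZero f hZ := hW ▸ hE.admMono_of_isZero f hZ
  hasPushout f g hf := by
    rw [hW] at hf
    obtain ⟨P, inl, inr, h, -⟩ := hE.exists_isPushout hf g
    exact h.hasPushout
  cof_cobaseChange h hf := by
    rw [hW] at hf ⊢
    exact hE.admMono_of_isPushout hf h
  weq_of_isIso := hiso
  gluing := by
    rw [hW]
    exact hglue

theorem isoCofWeq_isWaldhausen (hE : IsExactCategory.{w, w'} E) :
    (isoCofWeq E).IsWaldhausen := by
  refine isWaldhausen_of_admMono hE _ rfl
    (inferInstanceAs (MorphismProperty.isomorphisms B).IsMultiplicative) (fun f hf => hf) ?_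
  intro X Y Z P X' Y' Z' P' i j inl inr i' j' inl' inr' x y z φ h h' _ _ hx hy hz hi hj hl hr
  have : IsIso x := hx
  have : IsIso y := hy
  have : IsIso z := hz
  have h'' : IsPushout i j (y ≫ inl') (z ≫ inr') :=
    h'.of_iso' (asIso x) (asIso y) (asIso z) (Iso.refl _) (by simp [hi]) (by simp [hj])
      (by simp) (by simp)
  have : φ = (h.isoIsPushout (h' := h'')).hom := h.hom_ext (by simp [hl]) (by simp [hr])
  rw [this]
  exact inferInstanceAs (IsIso _)

theorem locCofWeq_isWaldhausen (hE : IsExactCategory.{w, w'} E) (hinj : EnoughInj E)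
    (hA : TwoOutOfThree E A) (hAinj : ∀ I : B, IsInj E I → A I) :
    (locCofWeq E A).IsWaldhausen := by
  refine isWaldhausen_of_admMono hE _ rfl
    { id_mem := fun X => weq_of_isIso hE hAinj (𝟙 X)
      comp_mem := fun f g => (locCofWeq_saturationAxiom hE hinj hA hAinj f g).1 }
    (fun f hf => weq_of_isIso hE hAinj f) ?_
  intro X Y Z P X' Y' Z' P' i j inl inr i' j' inl' inr' x y z φ h h' hi hi' hx hy hz ei ej el er
  obtain ⟨_, _, _, _, _, _, huv, h₁, h₂, h₃⟩ := exists_weq_iff hE hinj hA hAinj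
    (hE.inl_snd Y Z) (hE.inl_snd Y' Z') y (biprod.map y z) z (by simp) (by simp)
  have hyz := h₂.2 ((hA _ huv).2.1 (h₁.1 hy) (h₃.1 hz))
  -- A pushout square is the exact sequence `X → Y ⊞ Z → P`, so that gluing is two out of three for
  -- maps of exact sequences.
  obtain ⟨_, _, _, _, _, _, huv, h₁, h₂, h₃⟩ := exists_weq_iff hE hinj hA hAinj
    (hE.shortComplex_of_isPushout hi h) (hE.shortComplex_of_isPushout hi' h') x (biprod.map y z) φ
    (by ext <;> simp [ei, ej]) (by ext <;> simp [el, er])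
  exact h₃.2 ((hA _ huv).1 (h₁.1 hx) (h₂.1 hyz))

end

/-! ### Exact functors that kill `A` -/

section

variable {C : Type u'} [Category.{v'} C] {W : CofWeq C} {F : B ⥤ C}

/-- The extension axiom of `C` is applied to the map from `X = X → 0` to `X → Y → Q` given by
`𝟙`, `f` and `0 ⟶ Q`. -/
theorem weq_map_of_acyclicCof [HasZeroObject B] (hE : IsExactCategory.{w, w'} E)
    (hW : W.IsWaldhausen) (hext : W.ExtensionAxiom) (hF : IsExactFunctor (isoCofWeq E) W F)
    (hFA : SendsToAcyclic A W F) {X Y : B} {f : X ⟶ Y} (hf : acyclicCof E A f) :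
    W.weq (F.map f) := by
  obtain ⟨Q, p, w, h, hQ⟩ := hf
  have h0 : (isoCofWeq E).IsCofSeq (𝟙 X) (0 : X ⟶ 0) :=
    hE.isCofSeq rfl (hE.of_isIso_of_isZero (𝟙 X) (isZero_zero B))
  refine hext (F.map (𝟙 X)) (F.map f) (F.map (0 : (0 : B) ⟶ Q)) (hF.map_isCofSeq h0)
    (hF.map_isCofSeq (hE.isCofSeq rfl h)) rfl ?_ (hW.weq_of_isIso _ inferInstance)
    (hFA Q hQ _ (hF.map_isZero (isZero_zero B)))
  rw [← F.map_comp, ← F.map_comp, w, comp_zero]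

/-- An acyclic fibration splits, and its section is an acyclic cofibration because its cokernel
is the injective kernel. So saturation applies. -/
theorem weq_map_of_acyclicFib [HasZeroObject B] (hE : IsExactCategory.{w, w'} E)
    (hAinj : ∀ I : B, IsInj E I → A I) (hW : W.IsWaldhausen) (hext : W.ExtensionAxiom)
    (hsat : W.SaturationAxiom) (hF : IsExactFunctor (isoCofWeq E) W F)
    (hFA : SendsToAcyclic A W F) {X Y : B} {p : X ⟶ Y} (hp : acyclicFib E p) :
    W.weq (F.map p) := by
  obtain ⟨I, k, w, h, hI⟩ := hp
  obtain ⟨r, hr⟩ := hI k ⟨Y, p, w, h⟩ (𝟙 I)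
  obtain ⟨s, rfl⟩ := hE.exists_splitting h r hr
  have hsec : s.s ≫ p = 𝟙 Y := s.s_g
  have hs : acyclicCof E A s.s :=
    ⟨I, s.r, s.s_r, hE.of_splitting
      { r := p, s := k, f_r := hsec, s_g := hr, id := (add_comm _ _).trans s.id }, hAinj I hI⟩
  refine (hsat (F.map s.s) (F.map p)).2.1 (weq_map_of_acyclicCof hE hW hext hF hFA hs) ?_
  rw [← F.map_comp, hsec]
  exact hW.weq_of_isIso _ inferInstance

end

end Localization

end WaldLoc

theorem theorem6p3 {B : Type u} [Category.{v} B] [Preadditive B] [HasFiniteBiproducts B]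
    (E : ObjectProperty (ShortComplex B)) (hE : WaldLoc.IsExactCategory.{w, w'} E)
    (hinj : WaldLoc.EnoughInj E)
    (A : ObjectProperty B) (hA : WaldLoc.TwoOutOfThree E A)
    (hAinj : ∀ I : B, WaldLoc.IsInj E I → A I) :
    -- `B` and `(B, w_A)` are Waldhausen categories, and the latter satisfies both axioms
    (WaldLoc.isoCofWeq E).IsWaldhausen ∧
    (WaldLoc.locCofWeq E A).IsWaldhausen ∧
    (WaldLoc.locCofWeq E A).ExtensionAxiom ∧
    (WaldLoc.locCofWeq E A).SaturationAxiom ∧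
    -- the identity functor `B ⥤ (B, w_A)` is one of the functors under consideration
    WaldLoc.IsExactFunctor (WaldLoc.isoCofWeq E) (WaldLoc.locCofWeq E A) (𝟭 B) ∧
    WaldLoc.SendsToAcyclic A (WaldLoc.locCofWeq E A) (𝟭 B) ∧
    -- and each of these functors factors uniquely through it
    ∀ (C : Type u') [Category.{v'} C] (W : WaldLoc.CofWeq C),
      W.IsWaldhausen → W.ExtensionAxiom → W.SaturationAxiom →
      ∀ F : B ⥤ C, WaldLoc.IsExactFunctor (WaldLoc.isoCofWeq E) W F →
        WaldLoc.SendsToAcyclic A W F →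
        (∃! G : B ⥤ C,
          WaldLoc.IsExactFunctor (WaldLoc.locCofWeq E A) W G ∧ 𝟭 B ⋙ G = F) ∧
        (∀ {X Y : B} (f : X ⟶ Y), WaldLoc.acyclicCof E A f → W.weq (F.map f)) ∧
        (∀ {X Y : B} (f : X ⟶ Y), WaldLoc.acyclicFib E f → W.weq (F.map f)) := by
  have : HasBinaryBiproducts B := hasBinaryBiproducts_of_finite_biproducts B
  refine ⟨WaldLoc.isoCofWeq_isWaldhausen hE,
    WaldLoc.locCofWeq_isWaldhausen hE hinj hA hAinj,
    WaldLoc.locCofWeq_extensionAxiom hE hinj hA hAinj,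
    WaldLoc.locCofWeq_saturationAxiom hE hinj hA hAinj, ?_, ?_, ?_⟩
  · exact
      { map_isZero := fun h => h
        map_cof := fun _ h => h
        map_weq := fun f (_ : IsIso f) => WaldLoc.weq_of_isIso hE hAinj f
        map_isPushout := fun h _ => h }
  · intro X hX Z f hZ
    change Z ⟶ X at f
    exact ⟨X, f, 𝟙 X, ⟨X, 𝟙 X, _, hE.of_isZero_of_isIso f (𝟙 X) hZ, hX⟩,
      ⟨0, 0, _, hE.of_isZero_of_isIso 0 (𝟙 X) (isZero_zero B),
        WaldLoc.isInj_of_isZero (isZero_zero B)⟩, Category.comp_id f⟩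
  · intro C _ W hW hext hsat F hF hFA
    have hcof {X Y : B} (f : X ⟶ Y) (hf : WaldLoc.acyclicCof E A f) : W.weq (F.map f) :=
      WaldLoc.weq_map_of_acyclicCof hE hW hext hF hFA hf
    have hfib {X Y : B} (f : X ⟶ Y) (hf : WaldLoc.acyclicFib E f) : W.weq (F.map f) :=
      WaldLoc.weq_map_of_acyclicFib hE hAinj hW hext hsat hF hFA hf
    -- `𝟭 B ⋙ G` is `G` by definition, so the factorization of `F` can only be `F` itself.
    refine ⟨⟨F, ⟨⟨hF.map_isZero, hF.map_cof, ?_, hF.map_isPushout⟩, rfl⟩, fun G hG => hG.2⟩,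
      hcof, hfib⟩
    rintro X Y _ ⟨M, i, p, hi, hp, rfl⟩
    rw [F.map_comp]
    exact (hsat _ _).1 (hcof i hi) (hfib p hp)
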